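/- Let $\mathfrak g$ be a finite-dimensional real vector space (the Lie algebra of a torus), $S(\mathfrak g^*)$ the symmetric algebra of $\mathfrak g^*$, with degree $k$ part $S^k(\mathfrak g^*)$, and $Q(\mathfrak g^*)$ its quotient field. Let $\Gamma$ be a finite $d$-valent GKM graph: a finite graph with vertex set $V$, oriented edges $e$ with initial vertex $i(e)$, terminal vertex $t(e)$ and reversed edge $\bar e$, and an axial function $e\mapsto\alpha_e\in\mathfrak g^*$ such that $\alpha_{\bar e}=-\alpha_e$ and the weights $\alpha_e$, $i(e)=p$, are pairwise linearly independent for every vertex $p$, equipped with a compatible connection (bijections $\theta_e$ from the edges issuing from $i(e)$ to those issuing from $t(e)$, with $\theta_{\bar e}=\theta_e^{-1}$ and $\alpha_{\theta_e(e')}-\alpha_{e'}\in\mathbb R\,\alpha_e$ for $e'\ne e$). Let $\xi\in\mathfrak g$ be polarizing, i.e. $\alpha_e(\xi)\neq 0$ for all $e$. An edge $e$ is ascending if $\alpha_e(\xi)>0$ and descending if $\alpha_e(\xi)<0$, and a path is ascending if all its edges are. Let $\phi:V\to\mathbb R$ be an injective Morse function, i.e. $\phi(i(e))<\phi(t(e))$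 for every ascending $e$. For a vertex $p$ let $E_p^-$ be the set of descending edges $e$ with $i(e)=p$, $\sigma_p=|E_p^-|$, $\nu_p^+=\prod_{e\in E_p^-}\alpha_e$, and let $F_p$ be the set of vertices that can be joined to $p$ by an ascending path from $p$ (including $p$). Let $H(\Gamma,\alpha)$ be the ring of maps $h:V\to S(\mathfrak g^*)$ such that $h(i(e))$ and $h(t(e))$ have the same restriction to $\ker\alpha_e$ for every $e$. A Thom class of $p$ is an element $\tau\in H(\Gamma,\alpha)$ with values in $S^{\sigma_p}(\mathfrak g^*)$, supported in $F_p$, with $\tau(p)=\nu_p^+$. Let $\rho_e$ be the ring endomorphism of $S(\mathfrak g^*)$ with $\rho_e(\beta)=\beta-\frac{\beta(\xi)}{\alpha_e(\xi)}\alpha_e$ for $\beta\in\mathfrak g^*$. The class of $p$ constructed by interpolation is a map $\tau:V\to S(\mathfrak g^*)$ with $\tau(q)=0$ if $\phi(q)<\phi(p)$, $\tau(p)=\nu_p^+$, and $$\tau(q)=\sum_{e\in E_q^-}\frac{\prod_{e'\in E_q^-,\,e'\ne e}\alpha_{e'}}{\rho_e\bigl(\prod_{e'\in E_q^-,\,e'\neq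 e}\alpha_{e'}\bigr)}\,\rho_e\bigl(\tau(t(e))\bigr)\qquad\text{if }\phi(q)>\phi(p).$$ For an ascending edge $e$ from $p$ to $q$ the local intersection number is $\iota_e=\Theta_e/\alpha_e(\xi)$, where $$\Theta_e=\Theta_{pq}=\frac{\prod_{e'\in E_p^-}\rho_e(\alpha_{e'})}{\prod_{e''\in E_q^-\setminus\{\bar e\}}\rho_e(\alpha_{e''})}\in Q(\mathfrak g^*).$$ For an ascending path $\gamma$ from $p$ to $q$ with edges $e_1,\dots,e_m$, $m\ge1$, put $\hat\alpha_k=\alpha_{e_k}/\alpha_{e_k}(\xi)$ and $$E(\gamma)=(-1)^m\,\nu_q^+\,\frac{\iota_{e_1}}{\hat\alpha_m}\prod_{k=2}^m\frac{\iota_{e_k}}{\hat\alpha_{k-1}-\hat\alpha_k}\in Q(\mathfrak g^*);$$ for the trivial path at $q$ (the case $p=q$, $m=0$) put $E(\gamma)=\nu_q^+$. **Theorem.** For all vertices $p,q$ there are finitely many ascending paths from $p$ to $q$, and: 1. For every ascending path $\gamma$ from $p$ to $q$ with $m\ge1$ edges, $E(\gamma)$ is also equal to $$\nu_q^+\Bigl(\prod_{k=1}^m\Theta_{e_k}\Bigr)\frac{(-1)^m}{\alpha_{e_m}\prod_{k=1}^{m-1}\rho_{e_{k+1}}(\alpha_{e_k})}\quad\text{and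 to}\quad \frac{N_{e_m}}{\rho_{e_m}(N_{e_m})}\Bigl(\prod_{k=2}^m\frac{\rho_{e_k}(N_{e_{k-1}})}{\rho_{e_{k-1}}(N_{e_{k-1}})}\Bigr)\rho_{e_1}(\nu_p^+),$$ where $N_e=\prod_{e'\in E_{t(e)}^-\setminus\{\bar e\}}\alpha_{e'}$. 2. If $\sigma$ is strictly increasing along ascending paths, then every Thom class $\tau_p^+$ of $p$ (which is then unique) satisfies, for every $q\in V$, $$\tau_p^+(q)=\sum_{\gamma}E(\gamma),$$ the sum being over all ascending paths $\gamma$ from $p$ to $q$. 3. Without that assumption on $\sigma$, the same formula holds for every $q\in V$ when $\tau_p^+$ is the class of $p$ constructed by interpolation. If every vertex of $\Gamma$ has a Thom class, then for every $p$ this class exists (that is, its values are polynomials) and is a Thom class of $p$. -/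

import Mathlib

noncomputable section

namespace GKM

/-- A finite (multi)graph with a GKM action of a torus with Lie algebra `g`, given by its axial
function `α`, together with a compatible connection `θ`.  `V` is the set of vertices and `E` the set
of oriented edges. -/
structure GKMGraph (V E g : Type*) [AddCommGroup g] [Module ℝ g] where
  /-- initial vertex of an oriented edge -/
  i : E → V
  /-- terminal vertex of an oriented edge -/
  t : E → V
  /-- the same edge with the opposite orientation -/
  bar : E → E
  bar_bar : ∀ e, bar (bar e) = e
  bar_ne : ∀ e, bar e ≠ e
  i_bar : ∀ e, i (bar e) = t e
  /-- the common valence -/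
  d : ℕ
  valence : ∀ p, Nat.card {e // i e = p} = d
  /-- the axial function -/
  α : E → Module.Dual ℝ g
  α_bar : ∀ e, α (bar e) = -α e
  /-- the weights at a vertex are pairwise linearly independent -/
  indep : ∀ e e', i e = i e' → e ≠ e' → LinearIndependent ℝ ![α e, α e']
  /-- the connection: `θ e` restricts to a bijection from the edges issuing from `i e` to those
  issuing from `t e`, whose inverse is `θ (bar e)`; its other values play no role -/
  θ : E → E → E
  i_θ : ∀ e e', i e' = i e → i (θ e e') = t e
  θ_bar : ∀ e e', i e' = i e → θ (bar e) (θ e e') = e'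
  compat : ∀ e e', i e' = i e → e' ≠ e → ∃ c : ℝ, α (θ e e') = α e' + c • α e

/-- The symmetric algebra `S(g*)`. -/
abbrev S (g : Type*) [AddCommGroup g] [Module ℝ g] : Type _ :=
  SymmetricAlgebra ℝ (Module.Dual ℝ g)

/-- The quotient field `Q(g*)` of `S(g*)`. -/
abbrev Q (g : Type*) [AddCommGroup g] [Module ℝ g] : Type _ := FractionRing (S g)

variable {g : Type*} [AddCommGroup g] [Module ℝ g]

/-- The inclusion `g* → S(g*)`. -/
abbrev lin (β : Module.Dual ℝ g) : S g := SymmetricAlgebra.ι ℝ (Module.Dual ℝ g) β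

/-- The inclusion `S(g*) → Q(g*)`. -/
abbrev toQ (f : S g) : Q g := algebraMap (S g) (Q g) f

/-- The degree `k` part `S^k(g*)`. -/
def homogeneousPart (g : Type*) [AddCommGroup g] [Module ℝ g] (k : ℕ) : Submodule ℝ (S g) :=
  LinearMap.range (SymmetricAlgebra.ι ℝ (Module.Dual ℝ g)) ^ k

/-- Restriction of polynomials on `g` to a subspace `h`, as a map `S(g*) → S(h*)`. -/
def restrict (h : Submodule ℝ g) : S g →ₐ[ℝ] S h :=
  SymmetricAlgebra.lift (SymmetricAlgebra.ι ℝ (Module.Dual ℝ h) ∘ₗ h.subtype.dualMap)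

namespace GKMGraph

variable {V E : Type*} (Γ : GKMGraph V E g) (ξ : g)

/-- `ξ` is polarizing: no weight vanishes on it. -/
def IsPolarizing : Prop := ∀ e, Γ.α e ξ ≠ 0

/-- An oriented edge is ascending with respect to `ξ`. -/
def Ascending (e : E) : Prop := 0 < Γ.α e ξ

/-- An injective `ξ`-compatible Morse function. -/
def IsMorse (φ : V → ℝ) : Prop :=
  Function.Injective φ ∧ ∀ e, Γ.Ascending ξ e → φ (Γ.i e) < φ (Γ.t e)

open scoped Classical in
/-- `E_p^-`: the descending edges issuing from `p`. -/
def descEdges [Fintype E] (p : V) : Finset E :=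
  Finset.univ.filter fun e => Γ.i e = p ∧ Γ.α e ξ < 0

/-- The index `σ_p`. -/
def index [Fintype E] (p : V) : ℕ := (Γ.descEdges ξ p).card

/-- The index is strictly increasing along ascending paths. -/
def IndexIncreasing [Fintype E] : Prop :=
  ∀ e, Γ.Ascending ξ e → Γ.index ξ (Γ.i e) < Γ.index ξ (Γ.t e)

/-- `ν_p^+`, the product of the weights of the descending edges issuing from `p`. -/
def nu [Fintype E] (p : V) : S g := ∏ e ∈ Γ.descEdges ξ p, lin (Γ.α e)

/-- `IsAscPath p q γ`: the list of edges `γ` is an ascending path from `p` to `q`. -/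
def IsAscPath : V → V → List E → Prop
  | p, q, [] => p = q
  | p, q, e :: γ => Γ.i e = p ∧ Γ.Ascending ξ e ∧ IsAscPath (Γ.t e) q γ

/-- The flow-up `F_p`: the vertices which can be joined to `p` by an ascending path. -/
def flowUp (p : V) : Set V := {q | ∃ γ, Γ.IsAscPath ξ p q γ}

/-- The equivariant cohomology ring `H(Γ, α)`: the maps `h : V → S(g*)` such that, for every edge
`e`, the values of `h` at the two vertices of `e` have the same restriction to the annihilator of
`α_e` in `g`. -/
def cohomology : Subalgebra ℝ (V → S g) where
  carrier := {h | ∀ e, restrict (LinearMap.ker (Γ.α e)) (h (Γ.i e)) =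
    restrict (LinearMap.ker (Γ.α e)) (h (Γ.t e))}
  mul_mem' := by
    intro a b ha hb e
    simp only [Pi.mul_apply, map_mul, ha e, hb e]
  add_mem' := by
    intro a b ha hb e
    simp only [Pi.add_apply, map_add, ha e, hb e]
  algebraMap_mem' := by
    intro r e
    simp only [Pi.algebraMap_apply, AlgHom.commutes]

/-- `τ` is a Thom class of `p`: an element of `H^k(Γ, α)`, `k = σ_p`, supported on `F_p`, with value
`ν_p^+` at `p`. -/
structure IsThomClass [Fintype E] (p : V) (τ : V → S g) : Prop where
  mem : τ ∈ Γ.cohomology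
  degree : ∀ q, τ q ∈ homogeneousPart g (Γ.index ξ p)
  support : ∀ q, τ q ≠ 0 → q ∈ Γ.flowUp ξ p
  value : τ p = Γ.nu ξ p

/-- The ring homomorphism `ρ_e`, induced by `β ↦ β - (β(ξ) / α_e(ξ)) α_e`.  Its image is the
subring `S(g_ξ^*)` of `S(g*)`, where `g_ξ^*` is the annihilator of `ξ` in `g*`. -/
def rho (e : E) : S g →ₐ[ℝ] S g :=
  SymmetricAlgebra.lift (SymmetricAlgebra.ι ℝ (Module.Dual ℝ g) ∘ₗ
    (LinearMap.id - (Module.Dual.eval ℝ g ξ).smulRight ((Γ.α e ξ)⁻¹ • Γ.α e)))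

open scoped Classical in
/-- `τ` is the class of `p` obtained by successive interpolation (the sequence of "flip-flops"),
going up through the critical levels of `φ`: it vanishes below the level of `p`, is `ν_p^+` at `p`,
and its value at a vertex `q` above `p` is the Lagrange interpolant of the values at the lower
vertices of the descending edges issuing from `q`. -/
structure IsFlipFlopClass [Fintype E] (φ : V → ℝ) (p : V) (τ : V → S g) : Prop where
  below : ∀ q, φ q < φ p → τ q = 0
  value : τ p = Γ.nu ξ p
  above : ∀ q, φ p < φ q → toQ (τ q) = ∑ e ∈ Γ.descEdges ξ q,
    toQ (∏ e' ∈ (Γ.descEdges ξ q).erase e, lin (Γ.α e')) /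
      toQ (Γ.rho ξ e (∏ e' ∈ (Γ.descEdges ξ q).erase e, lin (Γ.α e'))) *
        toQ (Γ.rho ξ e (τ (Γ.t e)))

open scoped Classical in
/-- `Θ_{pq}` for the edge `e` from `p` to `q`. -/
def Theta [Fintype E] (e : E) : Q g :=
  toQ (∏ e' ∈ Γ.descEdges ξ (Γ.i e), Γ.rho ξ e (lin (Γ.α e'))) /
    toQ (∏ e' ∈ (Γ.descEdges ξ (Γ.t e)).erase (Γ.bar e), Γ.rho ξ e (lin (Γ.α e')))

/-- The local intersection number `ι_e = Θ_{pq} / α_e(ξ)`. -/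
def iota [Fintype E] (e : E) : Q g := Γ.Theta ξ e / algebraMap ℝ (Q g) (Γ.α e ξ)

/-- The normalized weight `α_e / α_e(ξ)`, as an element of `Q(g*)`. -/
def hat (e : E) : Q g := toQ (lin (Γ.α e)) / algebraMap ℝ (Q g) (Γ.α e ξ)

/-- The contribution
`E(γ) = (-1)^m ν_q (ι_{e_1} / α̂_m) ∏_{k=2}^m ι_{e_k} / (α̂_{k-1} - α̂_k)`
of a path `γ` with edges `e_1, …, e_m` ending at `q`; the trivial path contributes `ν_q`. -/
def pathTerm [Fintype E] (q : V) : List E → Q g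
  | [] => toQ (Γ.nu ξ q)
  | e :: γ => (-1) ^ (e :: γ).length * toQ (Γ.nu ξ q) *
      (Γ.iota ξ e / Γ.hat ξ ((e :: γ).getLast (List.cons_ne_nil e γ))) *
      (List.zipWith (fun a b => Γ.iota ξ b / (Γ.hat ξ a - Γ.hat ξ b)) (e :: γ) γ).prod

/-- The contribution of a nontrivial path in terms of the `Θ`'s:
`ν_q (∏_{k=1}^m Θ_{e_k}) (-1)^m / (α_{e_m} ∏_{k=1}^{m-1} ρ_{e_{k+1}}(α_{e_k}))`. -/
def pathTermTheta [Fintype E] (q : V) (γ : List E) (hγ : γ ≠ []) : Q g :=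
  toQ (Γ.nu ξ q) * (γ.map (Γ.Theta ξ)).prod *
    ((-1) ^ γ.length / (toQ (lin (Γ.α (γ.getLast hγ))) *
      (List.zipWith (fun a b => toQ (Γ.rho ξ b (lin (Γ.α a)))) γ γ.tail).prod))

open scoped Classical in
/-- The product of the weights of the descending edges issuing from `t e`, other than `bar e`. -/
def nuErase [Fintype E] (e : E) : S g :=
  ∏ e' ∈ (Γ.descEdges ξ (Γ.t e)).erase (Γ.bar e), lin (Γ.α e')

/-- The contribution of a nontrivial path from `p` as it comes out of the interpolation:
`Q(e_m) (∏_{k=2}^m Q(e_{k-1}, e_k)) ρ_{e_1}(ν_p)`, where, with `N_e` the product of the weights of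
the descending edges issuing from `t(e)` other than `bar e`, `Q(e) = N_e / ρ_e(N_e)` and
`Q(e, e') = ρ_{e'}(N_e) / ρ_e(N_e)`. -/
def pathTermInterp [Fintype E] (p : V) (γ : List E) (hγ : γ ≠ []) : Q g :=
  toQ (Γ.nuErase ξ (γ.getLast hγ)) /
      toQ (Γ.rho ξ (γ.getLast hγ) (Γ.nuErase ξ (γ.getLast hγ))) *
    (List.zipWith (fun a b => toQ (Γ.rho ξ b (Γ.nuErase ξ a)) / toQ (Γ.rho ξ a (Γ.nuErase ξ a)))
      γ γ.tail).prod *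
    toQ (Γ.rho ξ (γ.head hγ) (Γ.nu ξ p))

/-- The path integral `∑ E(γ)` over all ascending paths `γ` from `p` to `q` (a finite set, when a
Morse function exists). -/
def pathSum [Fintype E] (p q : V) : Q g :=
  ∑ᶠ γ ∈ {γ : List E | Γ.IsAscPath ξ p q γ}, Γ.pathTerm ξ q γ

end GKMGraph

end GKM

end

noncomputable section

namespace GKM

variable {g : Type*} [AddCommGroup g] [Module ℝ g]

/-! Restrict a polynomial `f` on `g` to the line `x + X ξ`. The point of this line in `ker α_e` is
at `X = -α̂_e(x)`, so the value there is `ρ_e f` (`eval_taylorAlong`). Pairwise independence makes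
the nodes for the edges of `E_q^-` distinct. If the degree of `f` in `X` is less than `σ_q`,
Lagrange interpolation evaluated at `X = 0` therefore recovers `f` from the `ρ_e f`
(`eq_sum_of_degree_lt`).

A cohomology class satisfies `ρ_e(τ(q)) = ρ_e(τ(t(e)))`. A Thom class of `p` whose values above `p`
have small degree along `ξ` is thus the interpolation class (`IsThomClass.isFlipFlopClass`). If `σ`
increases along ascending paths, total degree gives the bound; in general, Thom classes of higher
vertices are used to reduce the values modulo `ν_a^+` (`IsThomClass.exists_sub_mul`).

Unrolling the interpolation recursion gives a sum over paths, split by last edge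
(`IsFlipFlopClass.toQ_eq_pathSum`). A single path term is only rational, but its denominators lie in
the image of some `ρ_e`, which every `ρ_f` fixes pointwise, so `ρ_f` extends to it. -/

instance : IsDomain (S g) := SymmetricAlgebra.instIsDomain

theorem map_prod_div_map_prod {ι R K : Type*} [CommRing R] [Field K] (f : R →+* K) (s : Finset ι)
    (a b : ι → R) : f (∏ i ∈ s, a i) / f (∏ i ∈ s, b i) = ∏ i ∈ s, f (a i) / f (b i) := by
  rw [map_prod, map_prod, Finset.prod_div_distrib]

theorem lin_ne_zero {β : Module.Dual ℝ g} (hβ : β ≠ 0) : lin β ≠ 0 := by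
  intro h
  refine hβ (LinearMap.ext fun v => ?_)
  have := congrArg (SymmetricAlgebra.lift (Module.Dual.eval ℝ g v)) h
  simpa using this

theorem toQ_injective : Function.Injective (toQ (g := g)) :=
  IsFractionRing.injective (S g) (Q g)

theorem toQ_ne_zero {s : S g} (hs : s ≠ 0) : toQ s ≠ 0 := by
  intro h
  exact hs (toQ_injective (h.trans (map_zero _).symm))

theorem algebraMap_Q (c : ℝ) : algebraMap ℝ (Q g) c = toQ (algebraMap ℝ (S g) c) :=
  IsScalarTower.algebraMap_apply ℝ (S g) (Q g) c

/-! ### Homogeneous parts and expansion along `ξ`. -/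

theorem lin_mem_homogeneousPart (β : Module.Dual ℝ g) : lin β ∈ homogeneousPart g 1 := by
  rw [homogeneousPart, pow_one]
  exact LinearMap.mem_range_self _ _

theorem mul_mem_homogeneousPart {a b : S g} {m n : ℕ} (ha : a ∈ homogeneousPart g m)
    (hb : b ∈ homogeneousPart g n) : a * b ∈ homogeneousPart g (m + n) := by
  rw [homogeneousPart, pow_add]
  exact Submodule.mul_mem_mul ha hb

/-- The Taylor expansion `f ↦ f(· + X ξ)` of polynomials on `g` in the direction `ξ`. -/
def taylorAlong (ξ : g) : S g →ₐ[ℝ] Polynomial (Q g) :=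
  SymmetricAlgebra.lift
    ((Polynomial.CAlgHom (R := ℝ) (A := Q g)).toLinearMap ∘ₗ
        (Algebra.linearMap (S g) (Q g)).restrictScalars ℝ ∘ₗ
        SymmetricAlgebra.ι ℝ (Module.Dual ℝ g) +
      (Module.Dual.eval ℝ g ξ).smulRight (Polynomial.X : Polynomial (Q g)))

theorem taylorAlong_lin (ξ : g) (β : Module.Dual ℝ g) :
    taylorAlong ξ (lin β) =
      Polynomial.C (toQ (lin β)) + Polynomial.C (algebraMap ℝ (Q g) (β ξ)) * Polynomial.X := by
  rw [taylorAlong, SymmetricAlgebra.lift_ι_apply]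
  simp [Algebra.smul_def, Polynomial.algebraMap_apply]

theorem degree_taylorAlong_le (ξ : g) {k : ℕ} {f : S g} (hf : f ∈ homogeneousPart g k) :
    (taylorAlong ξ f).degree ≤ k := by
  induction k generalizing f with
  | zero =>
    rw [homogeneousPart, pow_zero, Submodule.mem_one] at hf
    obtain ⟨c, rfl⟩ := hf
    rw [AlgHom.commutes, Polynomial.algebraMap_apply]
    exact Polynomial.degree_C_le
  | succ k ih =>
    rw [homogeneousPart, pow_succ] at hf
    induction hf using Submodule.mul_induction_on' with
    | mem_mul_mem a ha b hb =>
      obtain ⟨β, rfl⟩ := hb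
      rw [map_mul]
      refine (Polynomial.degree_mul_le _ _).trans ?_
      push_cast
      refine add_le_add (ih ha) ?_
      change (taylorAlong ξ (lin β)).degree ≤ 1
      rw [taylorAlong_lin, add_comm]
      exact Polynomial.degree_linear_le
    | add a _ b _ iha ihb =>
      rw [map_add]
      exact (Polynomial.degree_add_le _ _).trans (max_le iha ihb)

theorem eval_zero_taylorAlong (ξ : g) (f : S g) : (taylorAlong ξ f).eval 0 = toQ f := by
  have h : ((Polynomial.aeval (0 : Q g)).restrictScalars ℝ).comp (taylorAlong ξ) =
      IsScalarTower.toAlgHom ℝ (S g) (Q g) := by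
    refine SymmetricAlgebra.algHom_ext (LinearMap.ext fun β => ?_)
    change Polynomial.aeval (0 : Q g) (taylorAlong ξ (lin β)) = toQ (lin β)
    rw [taylorAlong_lin]
    simp
  have := DFunLike.congr_fun h f
  simpa [Polynomial.aeval_def, Polynomial.eval₂_eq_eval_map] using this

namespace GKMGraph

variable {V E : Type*} (Γ : GKMGraph V E g) {ξ : g}

/-! ### The projections `ρ_e`. -/

section rho

variable (ξ) in
theorem rho_lin (e : E) (β : Module.Dual ℝ g) :
    Γ.rho ξ e (lin β) = lin (β - (β ξ / Γ.α e ξ) • Γ.α e) := by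
  rw [rho, SymmetricAlgebra.lift_ι_apply]
  simp [div_eq_mul_inv, smul_smul]

/-- The image of `ρ_a` is generated by linear forms vanishing on `ξ`, and `ρ_b` fixes those. -/
theorem rho_rho {a b : E} (ha : Γ.α a ξ ≠ 0) (f : S g) :
    Γ.rho ξ b (Γ.rho ξ a f) = Γ.rho ξ a f := by
  have h : (Γ.rho ξ b).comp (Γ.rho ξ a) = Γ.rho ξ a := by
    refine SymmetricAlgebra.algHom_ext (LinearMap.ext fun β => ?_)
    change Γ.rho ξ b (Γ.rho ξ a (lin β)) = Γ.rho ξ a (lin β)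
    rw [rho_lin, rho_lin]
    simp [ha]
  exact DFunLike.congr_fun h f

variable (ξ) in
theorem rho_bar (e : E) : Γ.rho ξ (Γ.bar e) = Γ.rho ξ e := by
  refine SymmetricAlgebra.algHom_ext (LinearMap.ext fun β => ?_)
  change Γ.rho ξ (Γ.bar e) (lin β) = Γ.rho ξ e (lin β)
  rw [rho_lin, rho_lin, Γ.α_bar]
  simp [div_neg]

theorem rho_lin_ne_zero {e e' : E} (h : LinearIndependent ℝ ![Γ.α e, Γ.α e']) :
    Γ.rho ξ e (lin (Γ.α e')) ≠ 0 := by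
  rw [rho_lin]
  refine lin_ne_zero fun h0 => ?_
  rw [LinearIndependent.pair_iff] at h
  have := h (-(Γ.α e' ξ / Γ.α e ξ)) 1 (by rw [← h0]; module)
  exact one_ne_zero this.2

/-- `ρ_e` is pullback along the projection `π` of `g` onto `ker α_e` in the direction `ξ`, so it
factors through restriction to `ker α_e`. -/
theorem rho_eq_of_restrict_eq {e : E} (he : Γ.α e ξ ≠ 0) {a b : S g}
    (h : restrict (LinearMap.ker (Γ.α e)) a = restrict (LinearMap.ker (Γ.α e)) b) :
    Γ.rho ξ e a = Γ.rho ξ e b := by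
  let π : g →ₗ[ℝ] LinearMap.ker (Γ.α e) :=
    (LinearMap.id - (Γ.α e).smulRight ((Γ.α e ξ)⁻¹ • ξ)).codRestrict _ fun v => by
      simp [he]
  have hπ : (SymmetricAlgebra.lift (SymmetricAlgebra.ι ℝ (Module.Dual ℝ g) ∘ₗ π.dualMap)).comp
      (restrict (LinearMap.ker (Γ.α e))) = Γ.rho ξ e := by
    refine SymmetricAlgebra.algHom_ext (LinearMap.ext fun β => ?_)
    change SymmetricAlgebra.lift _ (restrict _ (lin β)) = Γ.rho ξ e (lin β)
    rw [rho_lin, restrict, SymmetricAlgebra.lift_ι_apply]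
    simp only [LinearMap.comp_apply, SymmetricAlgebra.lift_ι_apply]
    congr 1
    ext v
    change β (v - Γ.α e v • ((Γ.α e ξ)⁻¹ • ξ)) = β v - (β ξ / Γ.α e ξ) * Γ.α e v
    simp only [map_sub, map_smul, smul_eq_mul]
    ring
  rw [← hπ, AlgHom.comp_apply, AlgHom.comp_apply, h]

variable (ξ) in
theorem toQ_rho_lin (e : E) (β : Module.Dual ℝ g) :
    toQ (Γ.rho ξ e (lin β)) = toQ (lin β) -
      algebraMap ℝ (Q g) (β ξ) / algebraMap ℝ (Q g) (Γ.α e ξ) * toQ (lin (Γ.α e)) := by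
  have h : lin (β - (β ξ / Γ.α e ξ) • Γ.α e) =
      lin β - algebraMap ℝ (S g) (β ξ / Γ.α e ξ) * lin (Γ.α e) := by
    rw [lin, map_sub, map_smul, Algebra.smul_def]
  rw [rho_lin, h, ← map_div₀, algebraMap_Q, toQ, map_sub, map_mul]

variable (ξ) in
theorem eval_taylorAlong (e : E) (f : S g) :
    (taylorAlong ξ f).eval (-Γ.hat ξ e) = toQ (Γ.rho ξ e f) := by
  have h : ((Polynomial.aeval (-Γ.hat ξ e)).restrictScalars ℝ).comp (taylorAlong ξ) =
      (IsScalarTower.toAlgHom ℝ (S g) (Q g)).comp (Γ.rho ξ e) := by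
    refine SymmetricAlgebra.algHom_ext (LinearMap.ext fun β => ?_)
    change Polynomial.aeval (-Γ.hat ξ e) (taylorAlong ξ (lin β)) = toQ (Γ.rho ξ e (lin β))
    rw [taylorAlong_lin, toQ_rho_lin, hat]
    simp only [map_add, map_mul, Polynomial.aeval_C, Polynomial.aeval_X, Algebra.algebraMap_self,
      RingHom.id_apply]
    ring
  have := DFunLike.congr_fun h f
  simpa [Polynomial.aeval_def, Polynomial.eval₂_eq_eval_map] using this

/-- Polynomials in forms vanishing on `ξ` are constant along `ξ`. -/
theorem degree_taylorAlong_rho_le {e : E} (he : Γ.α e ξ ≠ 0) (f : S g) :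
    (taylorAlong ξ (Γ.rho ξ e f)).degree ≤ 0 := by
  have h : (taylorAlong ξ).comp (Γ.rho ξ e) =
      ((Polynomial.CAlgHom (R := ℝ) (A := Q g)).comp
        (IsScalarTower.toAlgHom ℝ (S g) (Q g))).comp (Γ.rho ξ e) := by
    refine SymmetricAlgebra.algHom_ext (LinearMap.ext fun β => ?_)
    change taylorAlong ξ (Γ.rho ξ e (lin β)) = Polynomial.C (toQ (Γ.rho ξ e (lin β)))
    rw [rho_lin, taylorAlong_lin]
    simp [he]
  have h' : taylorAlong ξ (Γ.rho ξ e f) = Polynomial.C (toQ (Γ.rho ξ e f)) :=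
    DFunLike.congr_fun h f
  rw [h']
  exact Polynomial.degree_C_le

theorem rho_of_mem_homogeneousPart_zero (e : E) {f : S g} (hf : f ∈ homogeneousPart g 0) :
    Γ.rho ξ e f = f := by
  rw [homogeneousPart, pow_zero, Submodule.mem_one] at hf
  obtain ⟨c, rfl⟩ := hf
  exact AlgHom.commutes _ _

variable (ξ) in
theorem rho_mem_homogeneousPart (e : E) {k : ℕ} {f : S g} (hf : f ∈ homogeneousPart g k) :
    Γ.rho ξ e f ∈ homogeneousPart g k := by
  induction k generalizing f with
  | zero => rwa [Γ.rho_of_mem_homogeneousPart_zero e hf]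
  | succ k ih =>
    rw [homogeneousPart, pow_succ] at hf
    induction hf using Submodule.mul_induction_on' with
    | mem_mul_mem a ha b hb =>
      obtain ⟨β, rfl⟩ := hb
      rw [map_mul]
      refine mul_mem_homogeneousPart (ih ha) ?_
      change Γ.rho ξ e (lin β) ∈ _
      rw [rho_lin]
      exact lin_mem_homogeneousPart _
    | add a _ b _ iha ihb => rw [map_add]; exact add_mem iha ihb

variable (ξ) in
theorem exists_eq_lin_mul_add_rho (e : E) {k : ℕ} {f : S g} (hf : f ∈ homogeneousPart g (k + 1)) :
    ∃ f' ∈ homogeneousPart g k, f = lin (Γ.α e) * f' + Γ.rho ξ e f := by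
  induction k generalizing f with
  | zero =>
    rw [homogeneousPart, zero_add, pow_one] at hf
    obtain ⟨β, rfl⟩ := hf
    refine ⟨algebraMap ℝ (S g) (β ξ / Γ.α e ξ), ?_, ?_⟩
    · rw [homogeneousPart, pow_zero, Submodule.mem_one]
      exact ⟨_, rfl⟩
    · change lin β = _ + Γ.rho ξ e (lin β)
      rw [rho_lin]
      simp [Algebra.smul_def]
      ring
  | succ k ih =>
    rw [homogeneousPart, pow_succ] at hf
    induction hf using Submodule.mul_induction_on' with
    | mem_mul_mem a ha b hb =>
      obtain ⟨β, rfl⟩ := hb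
      obtain ⟨a', ha', h⟩ := ih ha
      -- From `aβ - ρ(a)ρ(β) = (a - ρ(a))β + ρ(a)(β - ρ(β))`, with `α_e` divided out.
      refine ⟨a' * lin β + algebraMap ℝ (S g) (β ξ / Γ.α e ξ) * Γ.rho ξ e a, ?_, ?_⟩
      · refine add_mem (mul_mem_homogeneousPart ha' (lin_mem_homogeneousPart β)) ?_
        rw [← Algebra.smul_def]
        exact Submodule.smul_mem _ _ (Γ.rho_mem_homogeneousPart ξ e ha)
      · rw [map_mul]
        change a * lin β = _ + _ * Γ.rho ξ e (lin β)
        rw [rho_lin]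
        conv_lhs => rw [h]
        simp [Algebra.smul_def]
        ring
    | add a _ b _ iha ihb =>
      obtain ⟨a', ha', h1⟩ := iha
      obtain ⟨b', hb', h2⟩ := ihb
      refine ⟨a' + b', add_mem ha' hb', ?_⟩
      conv_lhs => rw [h1, h2]
      rw [map_add]
      ring

theorem prod_lin_mem_homogeneousPart (s : Finset E) :
    ∏ e ∈ s, lin (Γ.α e) ∈ homogeneousPart g s.card := by
  classical
  induction s using Finset.induction_on with
  | empty => simp [homogeneousPart]
  | insert a s ha ih =>
    rw [Finset.prod_insert ha, Finset.card_insert_of_notMem ha, add_comm]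
    exact mul_mem_homogeneousPart (lin_mem_homogeneousPart _) ih

/-- Division with remainder, with respect to the degree in the direction `ξ`, by a product of
weights which do not vanish on `ξ`. -/
theorem exists_eq_prod_mul_add (s : Finset E) (hs : ∀ e ∈ s, Γ.α e ξ ≠ 0) {k : ℕ} {f : S g}
    (hf : f ∈ homogeneousPart g k) :
    ∃ a r : S g, f = (∏ e ∈ s, lin (Γ.α e)) * a + r ∧
      (a = 0 ∨ ∃ j, j + s.card = k ∧ a ∈ homogeneousPart g j) ∧
      (taylorAlong ξ r).degree < s.card := by
  classical
  induction s using Finset.induction_on with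
  | empty => exact ⟨f, 0, by simp, Or.inr ⟨k, by simp, hf⟩, by simp⟩
  | insert e s he ih =>
    obtain ⟨a, r, hfr, ha, hr⟩ := ih fun e' he' => hs e' (Finset.mem_insert_of_mem he')
    rw [Finset.card_insert_of_notMem he, Finset.prod_insert he]
    have he0 := hs e (Finset.mem_insert_self e s)
    -- The new remainder: splitting `a = α_e a' + ρ_e a` moves `ρ_e a`, constant along `ξ`, out of
    -- the quotient, so the product has degree at most `s.card`.
    have hdeg : (taylorAlong ξ ((∏ e ∈ s, lin (Γ.α e)) * Γ.rho ξ e a + r)).degree <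
        ((s.card + 1 : ℕ) : WithBot ℕ) := by
      have hlt : (s.card : WithBot ℕ) < ((s.card + 1 : ℕ) : WithBot ℕ) := by
        exact_mod_cast Nat.lt_succ_self _
      rw [map_add, map_mul]
      refine (Polynomial.degree_add_le _ _).trans_lt (max_lt ?_ (hr.trans hlt))
      refine ((Polynomial.degree_mul_le _ _).trans (add_le_add
        (degree_taylorAlong_le ξ (Γ.prod_lin_mem_homogeneousPart s))
        (Γ.degree_taylorAlong_rho_le he0 a))).trans_lt ?_
      rwa [add_zero]
    have key : ∃ a' : S g, a = lin (Γ.α e) * a' + Γ.rho ξ e a ∧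
        (a' = 0 ∨ ∃ j, j + (s.card + 1) = k ∧ a' ∈ homogeneousPart g j) := by
      rcases ha with rfl | ⟨j, hj, ha⟩
      · exact ⟨0, by simp, Or.inl rfl⟩
      · cases j with
        | zero => exact ⟨0, by simp [Γ.rho_of_mem_homogeneousPart_zero e ha], Or.inl rfl⟩
        | succ j =>
          obtain ⟨a', ha', h⟩ := Γ.exists_eq_lin_mul_add_rho ξ e ha
          exact ⟨a', h, Or.inr ⟨j, by omega, ha'⟩⟩
    obtain ⟨a', h, ha'⟩ := key
    refine ⟨a', _, ?_, ha', hdeg⟩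
    conv_lhs => rw [hfr, h]
    ring

end rho

/-! ### Lagrange interpolation along `ξ`. -/

section interpolation

theorem hat_sub_hat {a : E} (ha : Γ.α a ξ ≠ 0) (b : E) :
    Γ.hat ξ a - Γ.hat ξ b =
      toQ (Γ.rho ξ b (lin (Γ.α a))) / algebraMap ℝ (Q g) (Γ.α a ξ) := by
  have ha' : algebraMap ℝ (Q g) (Γ.α a ξ) ≠ 0 := by simpa using ha
  rw [hat, hat, toQ_rho_lin]
  field_simp

open scoped Classical in
/-- Lagrange interpolation from the annihilators of pairwise independent weights. -/
theorem eq_sum_of_degree_lt (s : Finset E) (hs : ∀ e ∈ s, Γ.α e ξ ≠ 0)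
    (hind : ∀ e ∈ s, ∀ e' ∈ s, e ≠ e' → LinearIndependent ℝ ![Γ.α e, Γ.α e']) {f : S g}
    (hf : (taylorAlong ξ f).degree < s.card) :
    toQ f = ∑ e ∈ s, toQ (∏ e' ∈ s.erase e, lin (Γ.α e')) /
      toQ (Γ.rho ξ e (∏ e' ∈ s.erase e, lin (Γ.α e'))) * toQ (Γ.rho ξ e f) := by
  have hinj : Set.InjOn (fun e => -Γ.hat ξ e) s := by
    intro a ha b hb hab
    by_contra hne
    have h0 : Γ.hat ξ a - Γ.hat ξ b = 0 := sub_eq_zero.2 (neg_injective hab)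
    rw [Γ.hat_sub_hat (hs a ha) b, div_eq_zero_iff] at h0
    rcases h0 with h0 | h0
    · exact toQ_ne_zero (Γ.rho_lin_ne_zero (hind b hb a ha (Ne.symm hne))) h0
    · exact hs a ha (by simpa using h0)
  have h := congrArg (Polynomial.eval 0) (Lagrange.eq_interpolate hinj hf)
  rw [eval_zero_taylorAlong, Lagrange.interpolate_apply, Polynomial.eval_finsetSum] at h
  rw [h]
  refine Finset.sum_congr rfl fun e he => ?_
  rw [Polynomial.eval_mul, Polynomial.eval_C, eval_taylorAlong, mul_comm]
  congr 1
  rw [Lagrange.basis, Polynomial.eval_prod, map_prod, toQ, toQ]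
  refine Eq.trans ?_ (map_prod_div_map_prod _ _ _ _).symm
  -- The basis factor at `0` is `α̂_{e'} / (α̂_{e'} - α̂_e)`, which is `α_{e'} / ρ_e(α_{e'})` by
  -- `hat_sub_hat`.
  refine Finset.prod_congr rfl fun e' he' => ?_
  have he's := Finset.mem_of_mem_erase he'
  have h1 : -Γ.hat ξ e - -Γ.hat ξ e' = Γ.hat ξ e' - Γ.hat ξ e := by ring
  have hne : algebraMap ℝ (Q g) (Γ.α e' ξ) ≠ 0 := by simpa using hs e' he's
  rw [Lagrange.basisDivisor, h1, Γ.hat_sub_hat (hs e' he's) e, hat]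
  simp only [Polynomial.eval_mul, Polynomial.eval_C, Polynomial.eval_sub, Polynomial.eval_X]
  rw [zero_sub, neg_neg, inv_div, div_mul_div_comm, mul_comm, mul_div_mul_right _ _ hne]

end interpolation

end GKMGraph

/-! ### Product identities behind the three forms of `E(γ)`. -/

theorem prod_zipWith_tail_concat {E K : Type*} [CommMonoid K] (h : E → E → K) (γ : List E)
    (hγ : γ ≠ []) (f : E) :
    (List.zipWith h (γ ++ [f]) (γ ++ [f]).tail).prod =
      (List.zipWith h γ γ.tail).prod * h (γ.getLast hγ) f := by
  induction γ with
  | nil => exact absurd rfl hγ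
  | cons e γ ih =>
    cases γ with
    | nil => simp
    | cons e' γ =>
      have := ih (List.cons_ne_nil _ _)
      simp only [List.cons_append, List.tail_cons, List.zipWith_cons_cons, List.prod_cons,
        List.getLast_cons_cons] at this ⊢
      rw [this, mul_assoc]

/-- For `T = Θ`, `w = α`, `c = α(ξ)` and `r a b = ρ_b(α_a)`. The `c` in each `ι_{e_k}` cancels
against that of `α̂_k - α̂_{k+1}`, and the last one against that of `α̂_m`. -/
theorem prod_zipWith_telescope {E K : Type*} [Field K] (T w c : E → K) (r : E → E → K)
    (hc : ∀ e, c e ≠ 0) (h : ∀ a b, w a / c a - w b / c b = r a b / c a) (e : E) (γ : List E)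
    (l : E) (hl : (e :: γ).getLast (List.cons_ne_nil e γ) = l) :
    T e / c e / (w l / c l) *
        (List.zipWith (fun a b => T b / c b / (w a / c a - w b / c b)) (e :: γ) γ).prod =
      ((e :: γ).map T).prod / (w l * (List.zipWith r (e :: γ) γ).prod) := by
  induction γ generalizing e with
  | nil =>
    obtain rfl : e = l := by simpa using hl
    have := hc e
    simp only [List.zipWith_nil_right, List.prod_nil, List.map_cons, List.map_nil, List.prod_cons,
      mul_one]
    field_simp
  | cons f γ ih =>
    rw [List.getLast_cons_cons] at hl
    have := ih f hl
    rw [List.zipWith_cons_cons, List.zipWith_cons_cons, List.prod_cons, List.prod_cons,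
      List.map_cons, List.prod_cons, h]
    have hce := hc e
    have key : T e / c e / (w l / c l) * (T f / c f / (r e f / c e) *
        (List.zipWith (fun a b => T b / c b / (w a / c a - w b / c b)) (f :: γ) γ).prod) =
        (T e / r e f) * (T f / c f / (w l / c l) *
        (List.zipWith (fun a b => T b / c b / (w a / c a - w b / c b)) (f :: γ) γ).prod) := by
      field_simp
    rw [key, this, div_mul_div_comm]
    congr 1
    ring

/-- For `n e = ρ_e(ν_{i(e)}^+)` and `M b a = ρ_b(N_a)`. Each numerator `n b` after the first absorbs
one sign and one `r a b`; the remaining sign comes from `ν_q^+ = -α_{e_m} N_{e_m}`. -/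
theorem prod_map_eq_prod_zipWith {E K : Type*} [Field K] (T w N n : E → K) (r M : E → E → K)
    (hT : ∀ e, T e = n e / M e e) (e : E) (γ : List E)
    (hc : (e :: γ).IsChain fun a b => n b = -(r a b * M b a) ∧ r a b ≠ 0 ∧ M b a ≠ 0)
    (l : E) (hl : (e :: γ).getLast (List.cons_ne_nil e γ) = l) (hw : w l ≠ 0) :
    -(w l * N l) * ((e :: γ).map T).prod *
        ((-1) ^ (e :: γ).length / (w l * (List.zipWith r (e :: γ) γ).prod)) =
      N l / M l l * (List.zipWith (fun a b => M b a / M a a) (e :: γ) γ).prod * n e := by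
  induction γ generalizing e with
  | nil =>
    obtain rfl : e = l := by simpa using hl
    simp only [List.zipWith_nil_right, List.prod_nil, List.map_cons, List.map_nil, List.prod_cons,
      mul_one, hT, List.length_cons, List.length_nil]
    field_simp
    ring
  | cons f γ ih =>
    rw [List.getLast_cons_cons] at hl
    rw [List.isChain_cons_cons] at hc
    obtain ⟨⟨h1, h2, h3⟩, hc⟩ := hc
    have := ih f hc hl
    rw [List.zipWith_cons_cons, List.zipWith_cons_cons, List.prod_cons, List.prod_cons,
      List.map_cons, List.prod_cons, List.length_cons, pow_succ]
    have key : -(w l * N l) * (T e * ((f :: γ).map T).prod) *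
        ((-1) ^ (f :: γ).length * -1 / (w l * (r e f * (List.zipWith r (f :: γ) γ).prod))) =
        (-(w l * N l) * ((f :: γ).map T).prod *
        ((-1) ^ (f :: γ).length / (w l * (List.zipWith r (f :: γ) γ).prod))) *
        (-T e / r e f) := by
      rw [← mul_assoc, mul_comm (r e f), ← mul_assoc, div_mul_eq_div_div _ _ (r e f)]
      ring
    rw [key, this, h1, hT]
    field_simp

namespace GKMGraph

variable {V E : Type*} (Γ : GKMGraph V E g) {ξ : g}

/-! ### Ascending paths. -/

section paths

theorem isAscPath_append {p q : V} {γ δ : List E} :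
    Γ.IsAscPath ξ p q (γ ++ δ) ↔ ∃ r, Γ.IsAscPath ξ p r γ ∧ Γ.IsAscPath ξ r q δ := by
  induction γ generalizing p with
  | nil => simp [IsAscPath]
  | cons e γ ih => simp [IsAscPath, ih, and_assoc]

theorem isAscPath_concat {p q : V} {γ : List E} {f : E} :
    Γ.IsAscPath ξ p q (γ ++ [f]) ↔
      Γ.IsAscPath ξ p (Γ.i f) γ ∧ Γ.Ascending ξ f ∧ Γ.t f = q := by
  simp only [isAscPath_append, IsAscPath]
  constructor
  · rintro ⟨r, h, rfl, hf⟩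
    exact ⟨h, hf⟩
  · rintro ⟨h, hf⟩
    exact ⟨_, h, rfl, hf⟩

theorem IsAscPath.t_getLast {p q : V} {γ : List E} (h : Γ.IsAscPath ξ p q γ) (hγ : γ ≠ []) :
    Γ.t (γ.getLast hγ) = q := by
  rw [← List.dropLast_append_getLast hγ, isAscPath_concat] at h
  exact h.2.2

theorem IsAscPath.ascending {p q : V} {γ : List E} (h : Γ.IsAscPath ξ p q γ) {e : E}
    (he : e ∈ γ) : Γ.Ascending ξ e := by
  obtain ⟨a, b, rfl⟩ := List.append_of_mem he
  obtain ⟨r, -, -, h, -⟩ := Γ.isAscPath_append.1 h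
  exact h

variable {Γ} in
theorem IsMorse.lt_of_isAscPath {φ : V → ℝ} (hφ : Γ.IsMorse ξ φ) {p q : V} {γ : List E}
    (h : Γ.IsAscPath ξ p q γ) (hγ : γ ≠ []) : φ p < φ q := by
  induction γ generalizing p with
  | nil => exact absurd rfl hγ
  | cons e γ ih =>
    obtain ⟨rfl, he, h⟩ := h
    rcases eq_or_ne γ [] with rfl | hγ
    · obtain rfl : Γ.t e = q := h
      exact hφ.2 e he
    · exact (hφ.2 e he).trans (ih h hγ)

variable {Γ} in
theorem IsMorse.le_of_mem_flowUp {φ : V → ℝ} (hφ : Γ.IsMorse ξ φ) {p q : V}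
    (h : q ∈ Γ.flowUp ξ p) : φ p ≤ φ q := by
  obtain ⟨γ, h⟩ := h
  rcases eq_or_ne γ [] with rfl | hγ
  · obtain rfl : p = q := h
    exact le_rfl
  · exact (hφ.lt_of_isAscPath h hγ).le

variable {Γ} in
theorem IsMorse.eq_nil_of_isAscPath_self {φ : V → ℝ} (hφ : Γ.IsMorse ξ φ) {p : V} {γ : List E}
    (h : Γ.IsAscPath ξ p p γ) : γ = [] := by
  by_contra hγ
  exact lt_irrefl _ (hφ.lt_of_isAscPath h hγ)

variable {Γ} in
theorem IsMorse.nodup_of_isAscPath {φ : V → ℝ} (hφ : Γ.IsMorse ξ φ) {p q : V} {γ : List E}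
    (h : Γ.IsAscPath ξ p q γ) : γ.Nodup := by
  induction γ generalizing p with
  | nil => exact List.nodup_nil
  | cons e γ ih =>
    obtain ⟨rfl, he, h⟩ := h
    refine List.nodup_cons.2 ⟨fun hmem => ?_, ih h⟩
    obtain ⟨a, b, rfl⟩ := List.append_of_mem hmem
    obtain ⟨r, ha, hr, -⟩ := Γ.isAscPath_append.1 h
    have h1 := hφ.le_of_mem_flowUp (p := Γ.t e) (q := r) ⟨a, ha⟩
    have h2 := hφ.2 e he
    rw [hr] at h2
    exact h2.not_ge h1

variable {Γ} in
theorem IsMorse.finite_isAscPath [Fintype E] {φ : V → ℝ} (hφ : Γ.IsMorse ξ φ) (p q : V) :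
    {γ : List E | Γ.IsAscPath ξ p q γ}.Finite := by
  refine (List.finite_length_le E (Fintype.card E)).subset fun γ hγ => ?_
  exact (hφ.nodup_of_isAscPath hγ).length_le_card

variable {Γ} in
theorem flowUp_subset {p q : V} (hq : q ∈ Γ.flowUp ξ p) : Γ.flowUp ξ q ⊆ Γ.flowUp ξ p := by
  obtain ⟨γ, hγ⟩ := hq
  rintro r ⟨δ, hδ⟩
  exact ⟨γ ++ δ, Γ.isAscPath_append.2 ⟨q, hγ, hδ⟩⟩

variable {Γ} in
theorem const_mem_cohomology (a : S g) : (fun _ => a) ∈ Γ.cohomology := fun _ => rfl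

end paths

/-! ### Descending weights and nonvanishing of the denominators. -/

section products

theorem ascending_bar {e : E} : Γ.Ascending ξ (Γ.bar e) ↔ Γ.α e ξ < 0 := by
  simp [Ascending, Γ.α_bar]

theorem t_bar (e : E) : Γ.t (Γ.bar e) = Γ.i e := by
  rw [← Γ.i_bar, Γ.bar_bar]

variable [Fintype E]

theorem mem_descEdges {p : V} {e : E} : e ∈ Γ.descEdges ξ p ↔ Γ.i e = p ∧ Γ.α e ξ < 0 := by
  simp [descEdges]

theorem bar_mem_descEdges {e : E} {q : V} :
    Γ.bar e ∈ Γ.descEdges ξ q ↔ Γ.Ascending ξ e ∧ Γ.t e = q := by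
  rw [mem_descEdges, Γ.i_bar, ← ascending_bar, Γ.bar_bar, and_comm]

theorem nu_t {e : E} (he : Γ.Ascending ξ e) :
    Γ.nu ξ (Γ.t e) = -(lin (Γ.α e) * Γ.nuErase ξ e) := by
  classical
  rw [nu, ← Finset.mul_prod_erase _ _ (Γ.bar_mem_descEdges.2 ⟨he, rfl⟩), nuErase, Γ.α_bar, lin,
    map_neg, neg_mul]

theorem Theta_eq (e : E) : Γ.Theta ξ e =
    toQ (Γ.rho ξ e (Γ.nu ξ (Γ.i e))) / toQ (Γ.rho ξ e (Γ.nuErase ξ e)) := by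
  rw [Theta, nu, nuErase, map_prod, map_prod]

theorem linearIndependent_of_ascending {e e' : E} (he : Γ.Ascending ξ e)
    (he' : e' ∈ Γ.descEdges ξ (Γ.i e)) : LinearIndependent ℝ ![Γ.α e, Γ.α e'] := by
  rw [mem_descEdges] at he'
  refine Γ.indep _ _ he'.1.symm ?_
  rintro rfl
  exact lt_asymm he he'.2

theorem rho_nuErase_ne_zero {a b : E} (hb : Γ.Ascending ξ b) (hab : Γ.t a = Γ.i b) :
    Γ.rho ξ b (Γ.nuErase ξ a) ≠ 0 := by
  rw [nuErase, map_prod, hab]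
  classical
  refine Finset.prod_ne_zero_iff.2 fun e he => Γ.rho_lin_ne_zero ?_
  exact Γ.linearIndependent_of_ascending hb (Finset.mem_of_mem_erase he)

theorem rho_weight_ne_zero {a b : E} (ha : Γ.Ascending ξ a) (hb : Γ.Ascending ξ b)
    (hab : Γ.t a = Γ.i b) : Γ.rho ξ b (lin (Γ.α a)) ≠ 0 := by
  have h := Γ.rho_lin_ne_zero (ξ := ξ) (Γ.linearIndependent_of_ascending hb (e' := Γ.bar a)
    (Γ.bar_mem_descEdges.2 ⟨ha, hab⟩))
  rw [Γ.α_bar, lin, map_neg, map_neg] at h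
  exact neg_ne_zero.1 h

/-- Since `ρ_e = ρ_{bar e}`, independence of the weights at `t(e)` applies with `bar e` as one of
the edges. -/
theorem rho_nuErase_self_ne_zero (ξ : g) (e : E) :
    Γ.rho ξ e (Γ.nuErase ξ e) ≠ 0 := by
  rw [nuErase, map_prod, ← Γ.rho_bar]
  classical
  refine Finset.prod_ne_zero_iff.2 fun e' he' => Γ.rho_lin_ne_zero ?_
  obtain ⟨hne, hmem⟩ := Finset.mem_erase.1 he'
  exact Γ.indep _ _ ((Γ.i_bar e).trans (Γ.mem_descEdges.1 hmem).1.symm) hne.symm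

end products

/-! ### Equality of the forms of `E(γ)`. -/

section pathTerms

variable [Fintype E]

theorem pathTerm_eq_pathTermTheta (hξ : Γ.IsPolarizing ξ) (q : V) (γ : List E) (hγ : γ ≠ []) :
    Γ.pathTerm ξ q γ = Γ.pathTermTheta ξ q γ hγ := by
  cases γ with
  | nil => exact absurd rfl hγ
  | cons e γ =>
    have h := prod_zipWith_telescope (Γ.Theta ξ) (fun e => toQ (lin (Γ.α e)))
      (fun e => algebraMap ℝ (Q g) (Γ.α e ξ)) (fun a b => toQ (Γ.rho ξ b (lin (Γ.α a))))
      (fun e => by simpa using hξ e) (fun a b => Γ.hat_sub_hat (hξ a) b) e γ _ rfl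
    rw [pathTerm, pathTermTheta, mul_assoc]
    refine (congrArg (((-1) ^ (e :: γ).length * toQ (Γ.nu ξ q)) * ·) h).trans ?_
    simp only [List.tail_cons]
    ring

theorem isChain_of_isAscPath {p q : V} {γ : List E} (h : Γ.IsAscPath ξ p q γ) :
    γ.IsChain fun a b => toQ (Γ.rho ξ b (Γ.nu ξ (Γ.i b))) =
        -(toQ (Γ.rho ξ b (lin (Γ.α a))) * toQ (Γ.rho ξ b (Γ.nuErase ξ a))) ∧
      toQ (Γ.rho ξ b (lin (Γ.α a))) ≠ 0 ∧ toQ (Γ.rho ξ b (Γ.nuErase ξ a)) ≠ 0 := by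
  induction γ generalizing p with
  | nil => exact List.isChain_nil
  | cons e γ ih =>
    cases γ with
    | nil => exact List.isChain_singleton _
    | cons f γ =>
      obtain ⟨-, he, h⟩ := h
      refine List.isChain_cons_cons.2 ⟨⟨?_, ?_, ?_⟩, ih h⟩
      · rw [h.1, Γ.nu_t he, map_neg, map_mul, toQ, map_neg, map_mul]
      · exact toQ_ne_zero (Γ.rho_weight_ne_zero he h.2.1 h.1.symm)
      · exact toQ_ne_zero (Γ.rho_nuErase_ne_zero h.2.1 h.1.symm)

theorem pathTermTheta_eq_pathTermInterp {p q : V} {γ : List E} (h : Γ.IsAscPath ξ p q γ)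
    (hγ : γ ≠ []) : Γ.pathTermTheta ξ q γ hγ = Γ.pathTermInterp ξ p γ hγ := by
  have hlast := h.ascending Γ (List.getLast_mem hγ)
  have hq := h.t_getLast Γ hγ
  have hchain := Γ.isChain_of_isAscPath h
  cases γ with
  | nil => exact absurd rfl hγ
  | cons e γ =>
    have hw : Γ.α ((e :: γ).getLast hγ) ≠ 0 := by
      intro h0
      rw [Ascending, h0] at hlast
      exact lt_irrefl _ hlast
    have := prod_map_eq_prod_zipWith (Γ.Theta ξ) (fun e => toQ (lin (Γ.α e)))
      (fun e => toQ (Γ.nuErase ξ e)) (fun e => toQ (Γ.rho ξ e (Γ.nu ξ (Γ.i e))))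
      (fun a b => toQ (Γ.rho ξ b (lin (Γ.α a)))) (fun b a => toQ (Γ.rho ξ b (Γ.nuErase ξ a)))
      Γ.Theta_eq e γ hchain _ rfl (toQ_ne_zero (lin_ne_zero hw))
    have hnu : toQ (Γ.nu ξ q) = -(toQ (lin (Γ.α ((e :: γ).getLast hγ))) *
        toQ (Γ.nuErase ξ ((e :: γ).getLast hγ))) := by
      rw [← hq, Γ.nu_t hlast, toQ, map_neg, map_mul]
    obtain ⟨rfl, -⟩ := h
    rw [pathTermTheta, pathTermInterp, hnu]
    exact this

theorem pathTerm_eq_pathTermInterp (hξ : Γ.IsPolarizing ξ) {p q : V} {γ : List E}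
    (h : Γ.IsAscPath ξ p q γ) (hγ : γ ≠ []) :
    Γ.pathTerm ξ q γ = Γ.pathTermInterp ξ p γ hγ :=
  (Γ.pathTerm_eq_pathTermTheta hξ q γ hγ).trans (Γ.pathTermTheta_eq_pathTermInterp h hγ)

end pathTerms

/-! ### Extending `ρ_e` to certain rational functions. -/

section extension

variable (ξ) in
/-- The graph of the partial extension of `ρ_e` to the elements of `Q(g*)` which have a nonzero
denominator fixed by `ρ_e`. -/
def RhoRel (e : E) (x y : Q g) : Prop :=
  ∃ d s : S g, d ≠ 0 ∧ Γ.rho ξ e d = d ∧ toQ d * x = toQ s ∧ toQ d * y = toQ (Γ.rho ξ e s)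

variable {Γ}

theorem rhoRel_toQ (e : E) (s : S g) : Γ.RhoRel ξ e (toQ s) (toQ (Γ.rho ξ e s)) :=
  ⟨1, s, one_ne_zero, map_one _, by simp, by simp⟩

theorem RhoRel.add {e : E} {x y x' y' : Q g} (h : Γ.RhoRel ξ e x y) (h' : Γ.RhoRel ξ e x' y') :
    Γ.RhoRel ξ e (x + x') (y + y') := by
  obtain ⟨d, s, hd, hρ, h1, h2⟩ := h
  obtain ⟨d', s', hd', hρ', h1', h2'⟩ := h'
  refine ⟨d * d', d' * s + d * s', mul_ne_zero hd hd', by rw [map_mul, hρ, hρ'], ?_, ?_⟩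
  · simp only [toQ, map_mul, map_add] at h1 h1' ⊢
    rw [← h1, ← h1']
    ring
  · simp only [toQ, map_mul, map_add, hρ, hρ'] at h2 h2' ⊢
    rw [← h2, ← h2']
    ring

theorem RhoRel.mul {e : E} {x y x' y' : Q g} (h : Γ.RhoRel ξ e x y) (h' : Γ.RhoRel ξ e x' y') :
    Γ.RhoRel ξ e (x * x') (y * y') := by
  obtain ⟨d, s, hd, hρ, h1, h2⟩ := h
  obtain ⟨d', s', hd', hρ', h1', h2'⟩ := h'
  refine ⟨d * d', s * s', mul_ne_zero hd hd', by rw [map_mul, hρ, hρ'], ?_, ?_⟩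
  · simp only [toQ, map_mul] at h1 h1' ⊢
    rw [← h1, ← h1']
    ring
  · simp only [toQ, map_mul] at h2 h2' ⊢
    rw [← h2, ← h2']
    ring

theorem rhoRel_inv {e : E} {d : S g} (hd : d ≠ 0) (hρ : Γ.rho ξ e d = d) :
    Γ.RhoRel ξ e (toQ d)⁻¹ (toQ d)⁻¹ :=
  ⟨d, 1, hd, hρ, by rw [mul_inv_cancel₀ (toQ_ne_zero hd), toQ, map_one],
    by rw [mul_inv_cancel₀ (toQ_ne_zero hd), map_one, toQ, map_one]⟩

theorem rhoRel_of_fixed {e : E} {d : S g} (hρ : Γ.rho ξ e d = d) :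
    Γ.RhoRel ξ e (toQ d) (toQ d) := by
  have := rhoRel_toQ (Γ := Γ) (ξ := ξ) e d
  rwa [hρ] at this

theorem RhoRel.sum {ι : Type*} {e : E} {x y : ι → Q g} (s : Finset ι)
    (h : ∀ i ∈ s, Γ.RhoRel ξ e (x i) (y i)) : Γ.RhoRel ξ e (∑ i ∈ s, x i) (∑ i ∈ s, y i) := by
  classical
  induction s using Finset.induction_on with
  | empty => simpa using rhoRel_toQ (Γ := Γ) (ξ := ξ) e 0
  | insert a s ha ih =>
    rw [Finset.sum_insert ha, Finset.sum_insert ha]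
    exact (h a (Finset.mem_insert_self a s)).add
      (ih fun i hi => h i (Finset.mem_insert_of_mem hi))

/-- A fixed denominator can be cleared, so the extension agrees with `ρ_e` whenever a sum of
rational terms is polynomial. -/
theorem RhoRel.eq_toQ_rho {e : E} {f : S g} {y : Q g} (h : Γ.RhoRel ξ e (toQ f) y) :
    y = toQ (Γ.rho ξ e f) := by
  obtain ⟨d, s, hd, hρ, h1, h2⟩ := h
  have hs : d * f = s := toQ_injective (by rw [← h1, toQ, map_mul])
  refine mul_left_cancel₀ (toQ_ne_zero hd) ?_
  rw [h2, ← hs, map_mul, hρ, toQ, map_mul]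

end extension

end GKMGraph

namespace GKMGraph

variable {V E : Type*} (Γ : GKMGraph V E g) {ξ : g} [Fintype E]

/-! ### The interpolation class as a path sum. -/

section flipFlop

/-- One interpolation step lengthens the path by `f`. In the interpolation form of a nontrivial
path's term, `ρ_f` changes only the leading `N_{e_m}`, and `ρ_f(N_{e_m}) / ρ_{e_m}(N_{e_m})` is the
factor that the longer path requires. -/
theorem exists_rhoRel_pathTerm (hξ : Γ.IsPolarizing ξ) {p : V} {f : E} (hf : Γ.Ascending ξ f)
    {γ : List E} (hγ : Γ.IsAscPath ξ p (Γ.i f) γ) :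
    ∃ y, Γ.RhoRel ξ f (Γ.pathTerm ξ (Γ.i f) γ) y ∧
      toQ (Γ.nuErase ξ f) / toQ (Γ.rho ξ f (Γ.nuErase ξ f)) * y =
        Γ.pathTerm ξ (Γ.t f) (γ ++ [f]) := by
  have hpath : Γ.IsAscPath ξ p (Γ.t f) (γ ++ [f]) := Γ.isAscPath_concat.2 ⟨hγ, hf, rfl⟩
  have hne : γ ++ [f] ≠ [] := by simp
  rw [Γ.pathTerm_eq_pathTermInterp hξ hpath hne]
  rcases eq_or_ne γ [] with rfl | hγ0
  · obtain rfl : p = Γ.i f := hγ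
    refine ⟨_, rhoRel_toQ f (Γ.nu ξ (Γ.i f)), ?_⟩
    simp only [pathTermInterp, List.nil_append, List.getLast_singleton, List.tail_cons,
      List.zipWith_nil_right, List.prod_nil, mul_one, List.head_cons]
  · rw [Γ.pathTerm_eq_pathTermInterp hξ hγ hγ0]
    have hfix : ∀ e s, Γ.rho ξ f (Γ.rho ξ e s) = Γ.rho ξ e s := fun e s => Γ.rho_rho (hξ e) s
    have hZ : ∀ δ δ' : List E,
        Γ.RhoRel ξ f
          (List.zipWith (fun a b => toQ (Γ.rho ξ b (Γ.nuErase ξ a)) /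
            toQ (Γ.rho ξ a (Γ.nuErase ξ a))) δ δ').prod
          (List.zipWith (fun a b => toQ (Γ.rho ξ b (Γ.nuErase ξ a)) /
            toQ (Γ.rho ξ a (Γ.nuErase ξ a))) δ δ').prod := by
      intro δ
      have hone : Γ.RhoRel ξ f 1 1 := by
        simpa using rhoRel_of_fixed (map_one (Γ.rho ξ f))
      induction δ with
      | nil => intro δ'; simpa using hone
      | cons a δ ih =>
        intro δ'
        cases δ' with
        | nil => simpa using hone
        | cons b δ' =>
          rw [List.zipWith_cons_cons, List.prod_cons]
          refine RhoRel.mul ?_ (ih δ')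
          rw [div_eq_mul_inv]
          exact (rhoRel_of_fixed (hfix _ _)).mul
            (rhoRel_inv (Γ.rho_nuErase_self_ne_zero ξ a) (hfix _ _))
    refine ⟨toQ (Γ.rho ξ f (Γ.nuErase ξ (γ.getLast hγ0))) *
      (toQ (Γ.rho ξ (γ.getLast hγ0) (Γ.nuErase ξ (γ.getLast hγ0))))⁻¹ *
      (List.zipWith (fun a b => toQ (Γ.rho ξ b (Γ.nuErase ξ a)) / toQ (Γ.rho ξ a (Γ.nuErase ξ a)))
      γ γ.tail).prod * toQ (Γ.rho ξ (γ.head hγ0) (Γ.nu ξ p)), ?_, ?_⟩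
    · rw [pathTermInterp, div_eq_mul_inv]
      refine (((rhoRel_toQ _ _).mul (rhoRel_inv (Γ.rho_nuErase_self_ne_zero ξ _) (hfix _ _))).mul
        (hZ γ _)).mul (rhoRel_of_fixed (hfix _ _))
    · rw [pathTermInterp, prod_zipWith_tail_concat _ γ hγ0, List.getLast_concat,
        List.head_append_of_ne_nil hγ0, div_eq_mul_inv, div_eq_mul_inv (toQ (Γ.rho ξ f _))]
      ring

variable {Γ}

theorem sum_isAscPath_eq_sum_descEdges {K : Type*} [AddCommMonoid K] {φ : V → ℝ}
    (hφ : Γ.IsMorse ξ φ) {p q : V} (hpq : p ≠ q) (F : List E → K) :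
    ∑ γ ∈ (hφ.finite_isAscPath p q).toFinset, F γ = ∑ e ∈ Γ.descEdges ξ q,
      ∑ γ ∈ (hφ.finite_isAscPath p (Γ.i (Γ.bar e))).toFinset, F (γ ++ [Γ.bar e]) := by
  rw [Finset.sum_sigma']
  symm
  refine Finset.sum_bij (fun x _ => x.2 ++ [Γ.bar x.1]) ?_ ?_ ?_ fun _ _ => rfl
  · rintro ⟨e, γ⟩ h
    simp only [Finset.mem_sigma, Set.Finite.mem_toFinset, Set.mem_ofPred_eq, mem_descEdges] at h ⊢
    exact Γ.isAscPath_concat.2 ⟨h.2, Γ.ascending_bar.2 h.1.2, (Γ.t_bar e).trans h.1.1⟩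
  · rintro ⟨e, γ⟩ - ⟨e', γ'⟩ - h
    obtain ⟨h1, h2⟩ := List.append_inj' h rfl
    have h3 : e = e' := by
      rw [← Γ.bar_bar e, ← Γ.bar_bar e', List.singleton_inj.1 h2]
    dsimp only at h1
    rw [h1, h3]
  · intro γ hγ
    simp only [Set.Finite.mem_toFinset, Set.mem_ofPred_eq] at hγ
    have hne : γ ≠ [] := by
      rintro rfl
      exact hpq hγ
    rw [← List.dropLast_append_getLast hne, isAscPath_concat] at hγ
    refine ⟨⟨Γ.bar (γ.getLast hne), γ.dropLast⟩, ?_, ?_⟩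
    · simp only [Finset.mem_sigma, Set.Finite.mem_toFinset, Set.mem_ofPred_eq, bar_mem_descEdges,
        Γ.bar_bar]
      exact ⟨hγ.2, hγ.1⟩
    · simp only [Γ.bar_bar]
      exact List.dropLast_append_getLast hne

theorem pathSum_eq_sum {φ : V → ℝ} (hφ : Γ.IsMorse ξ φ) (p q : V) :
    Γ.pathSum ξ p q = ∑ γ ∈ (hφ.finite_isAscPath p q).toFinset, Γ.pathTerm ξ q γ :=
  finsum_mem_eq_finite_toFinset_sum _ _

theorem IsFlipFlopClass.toQ_eq_pathSum [Finite V] (hξ : Γ.IsPolarizing ξ) {φ : V → ℝ}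
    (hφ : Γ.IsMorse ξ φ) {p : V} {τ : V → S g} (hτ : Γ.IsFlipFlopClass ξ φ p τ) (q : V) :
    toQ (τ q) = Γ.pathSum ξ p q := by
  rw [pathSum_eq_sum hφ]
  have hwf : WellFounded (InvImage (· < ·) φ) :=
    haveI : IsTrans V (InvImage (· < ·) φ) := ⟨fun _ _ _ h h' => lt_trans h h'⟩
    haveI : Std.Irrefl (InvImage (· < ·) φ) := ⟨fun _ h => lt_irrefl _ h⟩
    Finite.wellFounded_of_trans_of_irrefl _
  induction q using hwf.induction with
  | _ q ih =>
  rcases lt_trichotomy (φ q) (φ p) with hlt | heq | hgt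
  · rw [hτ.below q hlt, toQ, map_zero, Finset.sum_eq_zero]
    intro γ hγ
    rw [Set.Finite.mem_toFinset] at hγ
    exact absurd (hφ.le_of_mem_flowUp ⟨γ, hγ⟩) hlt.not_ge
  · obtain rfl := hφ.1 heq
    have hset : (hφ.finite_isAscPath q q).toFinset = {[]} := by
      ext γ
      rw [Set.Finite.mem_toFinset, Finset.mem_singleton]
      refine ⟨hφ.eq_nil_of_isAscPath_self, ?_⟩
      rintro rfl
      exact rfl
    rw [hset, Finset.sum_singleton, hτ.value, pathTerm]
  · have hpq : p ≠ q := by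
      rintro rfl
      exact lt_irrefl _ hgt
    rw [sum_isAscPath_eq_sum_descEdges hφ hpq, hτ.above q hgt]
    refine Finset.sum_congr rfl fun e he => ?_
    obtain ⟨rfl, hneg⟩ := Γ.mem_descEdges.1 he
    have hasc := Γ.ascending_bar.2 hneg
    have hlt : φ (Γ.t e) < φ (Γ.i e) := by
      have := hφ.2 _ hasc
      rwa [Γ.i_bar, Γ.t_bar] at this
    -- Quantifying over all lists, with `0` off the path set, lets `choose` give a function that can
    -- be summed.
    have hex : ∀ γ, ∃ y, γ ∈ (hφ.finite_isAscPath p (Γ.i (Γ.bar e))).toFinset →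
        Γ.RhoRel ξ (Γ.bar e) (Γ.pathTerm ξ (Γ.i (Γ.bar e)) γ) y ∧
        toQ (Γ.nuErase ξ (Γ.bar e)) / toQ (Γ.rho ξ (Γ.bar e) (Γ.nuErase ξ (Γ.bar e))) * y =
          Γ.pathTerm ξ (Γ.t (Γ.bar e)) (γ ++ [Γ.bar e]) := by
      intro γ
      by_cases hγ : γ ∈ (hφ.finite_isAscPath p (Γ.i (Γ.bar e))).toFinset
      · obtain ⟨y, hy⟩ := Γ.exists_rhoRel_pathTerm hξ hasc ((Set.Finite.mem_toFinset _).1 hγ)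
        exact ⟨y, fun _ => hy⟩
      · exact ⟨0, fun h => absurd h hγ⟩
    choose y hy using hex
    have hsum := RhoRel.sum _ fun γ hγ => (hy γ hγ).1
    have hih := ih (Γ.t e) hlt
    rw [← Γ.i_bar] at hih
    rw [← hih] at hsum
    -- By induction the path terms at the lower vertex add up to the polynomial `τ(t(e))`.
    have hrho := hsum.eq_toQ_rho
    have hN : Γ.nuErase ξ (Γ.bar e) =
        ∏ e' ∈ @Finset.erase E (Classical.decEq E) (Γ.descEdges ξ (Γ.i e)) e, lin (Γ.α e') := by
      rw [nuErase, Γ.bar_bar, Γ.t_bar]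
    have hs : ∑ γ ∈ (hφ.finite_isAscPath p (Γ.i (Γ.bar e))).toFinset,
        Γ.pathTerm ξ (Γ.t (Γ.bar e)) (γ ++ [Γ.bar e]) =
        toQ (Γ.nuErase ξ (Γ.bar e)) / toQ (Γ.rho ξ (Γ.bar e) (Γ.nuErase ξ (Γ.bar e))) *
          toQ (Γ.rho ξ (Γ.bar e) (τ (Γ.i (Γ.bar e)))) := by
      rw [← hrho, Finset.mul_sum]
      exact Finset.sum_congr rfl fun γ hγ => ((hy γ hγ).2).symm
    rw [Γ.t_bar, hN, Γ.rho_bar, Γ.i_bar] at hs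
    rw [Γ.i_bar]
    refine Eq.trans ?_ hs.symm
    congr!

end flipFlop

/-! ### Thom classes and the degree bound along `ξ`. -/

section thom

variable {Γ}

theorem IsThomClass.rho_eq (hξ : Γ.IsPolarizing ξ) {p : V} {τ : V → S g}
    (hτ : Γ.IsThomClass ξ p τ) (e : E) : Γ.rho ξ e (τ (Γ.i e)) = Γ.rho ξ e (τ (Γ.t e)) :=
  Γ.rho_eq_of_restrict_eq (hξ e) (hτ.mem e)

theorem IsThomClass.isFlipFlopClass (hξ : Γ.IsPolarizing ξ) {φ : V → ℝ} (hφ : Γ.IsMorse ξ φ)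
    {p : V} {τ : V → S g} (hτ : Γ.IsThomClass ξ p τ)
    (hdeg : ∀ q, φ p < φ q → (taylorAlong ξ (τ q)).degree < Γ.index ξ q) :
    Γ.IsFlipFlopClass ξ φ p τ where
  below q hq := by
    by_contra h
    exact hq.not_ge (hφ.le_of_mem_flowUp (hτ.support q h))
  value := hτ.value
  above q hq := by
    classical
    have h := Γ.eq_sum_of_degree_lt (ξ := ξ) (Γ.descEdges ξ q) (fun e _ => hξ e)
      (fun e he e' he' hne => Γ.indep e e'
        ((Γ.mem_descEdges.1 he).1.trans (Γ.mem_descEdges.1 he').1.symm) hne) (hdeg q hq)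
    rw [h]
    refine Finset.sum_congr rfl fun e he => ?_
    have := hτ.rho_eq hξ e
    rw [(Γ.mem_descEdges.1 he).1] at this
    rw [this]

theorem index_lt_of_isAscPath (hinc : Γ.IndexIncreasing ξ) {p q : V} {γ : List E}
    (h : Γ.IsAscPath ξ p q γ) (hγ : γ ≠ []) : Γ.index ξ p < Γ.index ξ q := by
  induction γ generalizing p with
  | nil => exact absurd rfl hγ
  | cons e γ ih =>
    obtain ⟨rfl, he, h⟩ := h
    rcases eq_or_ne γ [] with rfl | hγ
    · obtain rfl : Γ.t e = q := h
      exact hinc e he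
    · exact (hinc e he).trans (ih h hγ)

theorem IsThomClass.degree_lt_of_indexIncreasing (hinc : Γ.IndexIncreasing ξ) {p q : V}
    {τ : V → S g} (hτ : Γ.IsThomClass ξ p τ) (hpq : p ≠ q) :
    (taylorAlong ξ (τ q)).degree < Γ.index ξ q := by
  by_cases h0 : τ q = 0
  · rw [h0, map_zero, Polynomial.degree_zero]
    exact WithBot.bot_lt_coe _
  · obtain ⟨γ, hγ⟩ := hτ.support q h0
    refine (degree_taylorAlong_le ξ (hτ.degree q)).trans_lt ?_
    refine Nat.cast_lt.2 (index_lt_of_isAscPath hinc hγ ?_)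
    rintro rfl
    exact hpq hγ

/-- Subtracting a multiple of the Thom class of `a` makes the value of a Thom class at `a` small in
the direction `ξ`. -/
theorem IsThomClass.exists_sub_mul (hξ : Γ.IsPolarizing ξ) {φ : V → ℝ} (hφ : Γ.IsMorse ξ φ)
    {p a : V} {τ σ : V → S g} (hτ : Γ.IsThomClass ξ p τ) (hσ : Γ.IsThomClass ξ a σ)
    (hpa : φ p < φ a) :
    ∃ τ', Γ.IsThomClass ξ p τ' ∧ (∀ q, φ q < φ a → τ' q = τ q) ∧
      (taylorAlong ξ (τ' a)).degree < Γ.index ξ a := by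
  have hσ0 : ∀ q, φ q < φ a → σ q = 0 := fun q hq => by
    by_contra h
    exact hq.not_ge (hφ.le_of_mem_flowUp (hσ.support q h))
  -- If `τ a ≠ 0` then `a` lies in `F_p`, so the correction, supported in `F_a`, stays inside `F_p`.
  by_cases h0 : τ a = 0
  · refine ⟨τ, hτ, fun _ _ => rfl, ?_⟩
    rw [h0, map_zero, Polynomial.degree_zero]
    exact WithBot.bot_lt_coe _
  -- Divide `τ(a)` by `ν_a^+ = σ(a)`. The quotient `c` is zero or homogeneous of degree `σ_p - σ_a`,
  -- so subtracting `c σ` preserves the degree and leaves the remainder at `a`.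
  obtain ⟨c, r, hcr, hc, hr⟩ := Γ.exists_eq_prod_mul_add (ξ := ξ) (Γ.descEdges ξ a)
    (fun e _ => hξ e) (hτ.degree a)
  refine ⟨τ - (fun _ => c) * σ, ⟨?_, fun q => ?_, fun q hq => ?_, ?_⟩, fun q hq => ?_, ?_⟩
  · exact sub_mem hτ.mem (mul_mem (const_mem_cohomology c) hσ.mem)
  · refine sub_mem (hτ.degree q) ?_
    rcases hc with rfl | ⟨j, hj, hc⟩
    · simp
    · rw [← hj]
      exact mul_mem_homogeneousPart hc (hσ.degree q)
  · by_contra hmem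
    have h1 : τ q = 0 := by
      by_contra h
      exact hmem (hτ.support q h)
    have h2 : σ q = 0 := by
      by_contra h
      exact hmem (flowUp_subset (hτ.support a h0) (hσ.support q h))
    exact hq (by simp [h1, h2])
  · simp [hσ0 p hpa, hτ.value]
  · simp [hσ0 q hq]
  · have : (τ - (fun _ => c) * σ : V → S g) a = r := by
      simp only [Pi.sub_apply, Pi.mul_apply]
      rw [hσ.value, nu, hcr]
      ring
    rw [this]
    exact hr

/-- Vertices are corrected in increasing order of `φ`: the correction at `a` vanishes below `a`, so
the bounds already obtained persist. -/
theorem exists_isThomClass_degree_lt (hξ : Γ.IsPolarizing ξ) {φ : V → ℝ} (hφ : Γ.IsMorse ξ φ)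
    (hex : ∀ r, ∃ τ, Γ.IsThomClass ξ r τ) (p : V) (s : Finset V) (hs : ∀ q ∈ s, φ p < φ q) :
    ∃ τ, Γ.IsThomClass ξ p τ ∧ ∀ q ∈ s, (taylorAlong ξ (τ q)).degree < Γ.index ξ q := by
  classical
  induction s using Finset.induction_on_max_value φ with
  | empty =>
    obtain ⟨τ, hτ⟩ := hex p
    exact ⟨τ, hτ, by simp⟩
  | insert a s ha hmax ih =>
    obtain ⟨τ, hτ, hdeg⟩ := ih fun q hq => hs q (Finset.mem_insert_of_mem hq)
    obtain ⟨σ, hσ⟩ := hex a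
    obtain ⟨τ', hτ', heq, hdega⟩ :=
      hτ.exists_sub_mul hξ hφ hσ (hs a (Finset.mem_insert_self a s))
    refine ⟨τ', hτ', fun q hq => ?_⟩
    rcases Finset.mem_insert.1 hq with rfl | hq
    · exact hdega
    · have hne : φ q ≠ φ a := fun h => ha (hφ.1 h ▸ hq)
      rw [heq q (lt_of_le_of_ne (hmax q hq) hne)]
      exact hdeg q hq

end thom

end GKMGraph

end GKM

end

theorem theorem1p7 {V E g : Type*} [Fintype V] [Fintype E]
    [AddCommGroup g] [Module ℝ g] [FiniteDimensional ℝ g]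
    (Γ : GKM.GKMGraph V E g) (ξ : g) (hξ : Γ.IsPolarizing ξ)
    (φ : V → ℝ) (hφ : Γ.IsMorse ξ φ) :
    -- the sums are finite
    (∀ p q, {γ : List E | Γ.IsAscPath ξ p q γ}.Finite) ∧
    -- the combinatorial forms of the summands agree
    (∀ p q γ, Γ.IsAscPath ξ p q γ → ∀ hγ : γ ≠ [],
      Γ.pathTerm ξ q γ = Γ.pathTermInterp ξ p γ hγ ∧
      Γ.pathTerm ξ q γ = Γ.pathTermTheta ξ q γ hγ) ∧
    -- the formula when the index increases along ascending paths
    (Γ.IndexIncreasing ξ → ∀ p τ, Γ.IsThomClass ξ p τ →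
      ∀ q, GKM.toQ (τ q) = Γ.pathSum ξ p q) ∧
    -- the formula for the class constructed by interpolation, without that assumption
    (∀ p τ, Γ.IsFlipFlopClass ξ φ p τ → ∀ q, GKM.toQ (τ q) = Γ.pathSum ξ p q) ∧
    -- existence of that class, as a Thom class, on a graph that admits Thom classes
    ((∀ r, ∃ τ, Γ.IsThomClass ξ r τ) →
      ∀ p, ∃ τ, Γ.IsFlipFlopClass ξ φ p τ ∧ Γ.IsThomClass ξ p τ) := by
  classical
  refine ⟨hφ.finite_isAscPath, fun p q γ h hγ => ⟨Γ.pathTerm_eq_pathTermInterp hξ h hγ,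
    Γ.pathTerm_eq_pathTermTheta hξ q γ hγ⟩, fun hinc p τ hτ q => ?_,
    fun p τ hτ q => hτ.toQ_eq_pathSum hξ hφ q, fun hex p => ?_⟩
  · refine (hτ.isFlipFlopClass hξ hφ fun r hr => ?_).toQ_eq_pathSum hξ hφ q
    refine hτ.degree_lt_of_indexIncreasing hinc ?_
    rintro rfl
    exact lt_irrefl _ hr
  · obtain ⟨τ, hτ, hdeg⟩ := GKM.GKMGraph.exists_isThomClass_degree_lt hξ hφ hex p
      (Finset.univ.filter fun q => φ p < φ q) (by simp)
    exact ⟨τ, hτ.isFlipFlopClass hξ hφ fun q hq => hdeg q (by simpa using hq), hτ⟩
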